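/- By a space we mean an infinite topological space. Let $\Omega(X)$ be the family of all countable open covers $\mathcal U$ of $X$ with $X\notin\mathcal U$ such that each finite subset of $X$ is contained in some member of $\mathcal U$. Let $\gimel(\Gamma)(X)$ be the family of all countable open covers $\mathcal U$ of $X$ with $X\notin\mathcal U$ that have a bijective enumeration $\mathcal U=\{U_n : n\in\mathbb N\}$ for which there is an increasing $h:\mathbb N\to\mathbb N$ such that each $x\in X$ belongs to $\bigcup_{k=h(n)}^{h(n+1)-1}U_k$ for all but finitely many $n$. A space $X$ has the Gerlits–Nagy property $S_1(\Omega,\gimel(\Gamma))$ if for every sequence $\mathcal U_0,\mathcal U_1,\dots\in\Omega(X)$ there are $U_n\in\mathcal U_n$, $n\in\mathbb N$, with $\{U_n : n\in\mathbb N\}\in\gimel(\Gamma)(X)$. Let $\operatorname{add}(S_1(\Omega,\gimel(\Gamma)))$ be the minimal cardinal $\kappa$ such that some space without the Gerlits–Nagy property is a union of $\kappa$ subspaces that have it, and let $\operatorname{add}(\mathcal M)$ be the minimal cardinality of a family of meager subsets of $\mathbb R$ whose union is not meager. **Theorem.** Some space without the Gerlits–Nagy property is a union of subspaces that have it, and $$\operatorname{add}(S_1(\Omega,\gimel(\Gamma)))=\operatorname{add}(\mathcal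 M).$$ -/

import Mathlib

open Set Filter Cardinal

universe u

namespace SelectionPrinciples

/-- A countable open cover of the space `X`, where the whole space is not allowed to be a member
of the cover. -/
structure IsCountableOpenCover (X : Type u) [TopologicalSpace X] (𝒰 : Set (Set X)) : Prop where
  countable : 𝒰.Countable
  isOpen : ∀ U ∈ 𝒰, IsOpen U
  sUnion_eq : ⋃₀ 𝒰 = Set.univ
  univ_notMem : Set.univ ∉ 𝒰

/-- The family `Ω(X)`: countable open covers such that each finite subset of `X` is contained in
some member of the cover. -/
def omegaCovers (X : Type u) [TopologicalSpace X] : Set (Set (Set X)) :=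
  {𝒰 | IsCountableOpenCover X 𝒰 ∧ ∀ F : Set X, F.Finite → ∃ U ∈ 𝒰, F ⊆ U}

/-- The family `ℷ(Γ)(X)`: countable open covers with a bijective enumeration `e 0, e 1, …`
such that for some increasing `h : ℕ → ℕ`, each point of `X` belongs to
`e (h n) ∪ ⋯ ∪ e (h (n+1) - 1)` for all but finitely many `n`. In particular, the members of
`ℷ(Γ)(X)` are infinite; the choice of the enumeration is immaterial. -/
def gimelGammaCovers (X : Type u) [TopologicalSpace X] : Set (Set (Set X)) :=
  {𝒰 | IsCountableOpenCover X 𝒰 ∧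
    ∃ e : ℕ → Set X, Function.Injective e ∧ Set.range e = 𝒰 ∧
      ∃ h : ℕ → ℕ, StrictMono h ∧
        ∀ x : X, ∀ᶠ n in atTop, x ∈ ⋃ k ∈ Set.Ico (h n) (h (n + 1)), e k}

/-- The selection principle `S₁(𝒜, ℬ)`. -/
def SOne {X : Type u} (𝒜 ℬ : Set (Set (Set X))) : Prop :=
  ∀ 𝒰 : ℕ → Set (Set X), (∀ n, 𝒰 n ∈ 𝒜) →
    ∃ U : ℕ → Set X, (∀ n, U n ∈ 𝒰 n) ∧ Set.range U ∈ ℬ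

/-- The Gerlits–Nagy property `S₁(Ω, ℷ(Γ))`. -/
def GerlitsNagy (X : Type u) [TopologicalSpace X] : Prop :=
  SOne (omegaCovers X) (gimelGammaCovers X)

/-- The cardinals `κ` such that some (infinite) space outside the class `Q` is a union of `κ`
(infinite) subspaces belonging to the class `P`. -/
def unionDefects (P Q : ∀ (X : Type u) [TopologicalSpace X], Prop) : Set Cardinal.{u} :=
  {κ | ∃ (X : Type u) (_ : TopologicalSpace X) (𝒴 : Set (Set X)),
    Infinite X ∧ (∀ Y ∈ 𝒴, Infinite Y ∧ P Y) ∧ ⋃₀ 𝒴 = Set.univ ∧ #𝒴 = κ ∧ ¬ Q X}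

/-- `add(P, Q)`: the minimal cardinal `κ` such that some union of `κ` members of `P` is
not in `Q`. -/
noncomputable def addNumber₂ (P Q : ∀ (X : Type u) [TopologicalSpace X], Prop) : Cardinal.{u} :=
  sInf (unionDefects P Q)

/-- The additivity number `add(P) = add(P, P)` of a class of spaces. -/
noncomputable def addNumber (P : ∀ (X : Type u) [TopologicalSpace X], Prop) : Cardinal.{u} :=
  addNumber₂ P P

/-- `add(𝓜)`: the minimal cardinality of a family of meager subsets of the real line whose union
is not meager. -/
noncomputable def addMeager : Cardinal.{0} :=
  sInf {κ | ∃ 𝓕 : Set (Set ℝ), (∀ A ∈ 𝓕, IsMeagre A) ∧ ¬ IsMeagre (⋃₀ 𝓕) ∧ #𝓕 = κ}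

end SelectionPrinciples

/-! Bijective enumeration is inessential: the Gerlits–Nagy property is equivalent to
`HasBlockSelections`, which only asks that the indices catching a point meet almost all blocks of an
interval partition.

Upper bound: on a discrete space with the property, a single sequence guesses the sequences attached
to all points, correctly somewhere in almost every block (`HasBlockSelections.exists_eq`). This
gives domination, and then meagerness of any union of meager sets indexed by the space. So a family
witnessing add(𝓜), made discrete, lacks the property, while its countable subspaces have it.

Lower bound: binary sequences that differ from a given one in almost every block of a partition form
a meager set. For fewer than add(𝓜) such pairs the union is still meager, and avoiding it gives one
sequence and one partition, almost every block of which contains a block of each given partition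
with agreement there (`exists_agree_on_block`). Coding the selections of the pieces in bits merges
them into one (`exists_amalgam`). -/

namespace SelectionPrinciples

/-! ### Block selections and the Gerlits–Nagy property -/

/-- All but finitely many of the blocks `[h n, h (n + 1))` meet `A`. -/
def HitsBlocks (A : Set ℕ) (h : ℕ → ℕ) : Prop :=
  ∀ᶠ n in atTop, ∃ k ∈ Ico (h n) (h (n + 1)), k ∈ A

/-- From every sequence of open families, each of which contains the finite sets in its members,
one can select so that each point is caught in almost all blocks of some interval partition. -/
def HasBlockSelections (X : Type u) [TopologicalSpace X] : Prop :=
  ∀ U : ℕ → ℕ → Set X, (∀ n m, IsOpen (U n m)) →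
    (∀ n (F : Set X), F.Finite → ∃ m, F ⊆ U n m) →
    ∃ f h : ℕ → ℕ, StrictMono h ∧ ∀ x, HitsBlocks {k | x ∈ U k (f k)} h

theorem exists_ge_forall_le_of_pairwise_disjoint (D : ℕ → Finset ℕ)
    (hD : Pairwise fun m n => Disjoint (D m) (D n)) (p : ℕ) :
    ∃ m ≥ p, ∀ k ∈ D m, p ≤ k := by
  by_contra! H
  choose! k hk hkp using H
  have hinj : InjOn k (Ici p) := by
    intro a ha b hb hab
    by_contra hne
    exact Finset.disjoint_left.1 (hD hne) (hk a ha) (hab ▸ hk b hb)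
  have : (k '' Ici p).Infinite := (Set.Ici_infinite p).image hinj
  refine this ((finite_Iio p).subset ?_)
  rintro _ ⟨a, ha, rfl⟩
  exact hkp a ha

/-- Disjointness pushes the sets `D m` beyond any bound, so each block can be made long enough to
swallow a late one. -/
theorem exists_hitsBlocks_of_pairwise_disjoint {ι : Type*} (A : ι → Set ℕ) (D : ℕ → Finset ℕ)
    (hD : Pairwise fun m n => Disjoint (D m) (D n))
    (H : ∀ i, ∀ᶠ n in atTop, ∃ k ∈ D n, k ∈ A i) :
    ∃ h : ℕ → ℕ, StrictMono h ∧ ∀ i, HitsBlocks (A i) h := by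
  choose m hm hmD using exists_ge_forall_le_of_pairwise_disjoint D hD
  let h : ℕ → ℕ := fun n => Nat.rec 0 (fun _ p => max (p + 1) ((D (m p)).sup id + 1)) n
  have hs : ∀ n, h (n + 1) = max (h n + 1) ((D (m (h n))).sup id + 1) := fun n => rfl
  have hmono : StrictMono h := strictMono_nat_of_lt_succ fun n => by rw [hs]; omega
  refine ⟨h, hmono, fun i => ?_⟩
  obtain ⟨N, hN⟩ := eventually_atTop.1 (H i)
  refine eventually_atTop.2 ⟨N, fun n hn => ?_⟩
  obtain ⟨k, hk, hkA⟩ := hN (m (h n)) ((show N ≤ n from hn).trans (hmono.le_apply.trans (hm _)))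
  refine ⟨k, ⟨hmD _ k hk, ?_⟩, hkA⟩
  have : k ≤ (D (m (h n))).sup id := Finset.le_sup (f := id) hk
  rw [hs]; omega

theorem HitsBlocks.nonempty {A : Set ℕ} {h : ℕ → ℕ} (H : HitsBlocks A h) :
    A.Nonempty := by
  obtain ⟨n, k, -, hk⟩ := H.exists
  exact ⟨k, hk⟩

theorem GerlitsNagy.hasBlockSelections {X : Type u} [TopologicalSpace X] (hX : GerlitsNagy X) :
    HasBlockSelections X := by
  intro U hU hω
  -- Families containing the whole space are not in `Ω(X)`. If there are infinitely many, they alone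
  -- catch every point; otherwise a finite initial segment is dropped.
  by_cases hinf : ∃ᶠ n in atTop, ∃ m, U n m = Set.univ
  · have hinf' := Nat.frequently_atTop_iff_infinite.1 hinf
    have : ∀ n, ∃ m, (∃ m, U n m = Set.univ) → U n m = Set.univ := fun n => by
      by_cases h : ∃ m, U n m = Set.univ
      · exact ⟨h.choose, fun _ => h.choose_spec⟩
      · exact ⟨0, fun h' => absurd h' h⟩
    choose f hf using this
    let e := Nat.nth fun n => ∃ m, U n m = Set.univ
    refine ⟨f, exists_hitsBlocks_of_pairwise_disjoint _ (fun n => {e n}) ?_ ?_⟩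
    · intro a b hab
      simpa using fun h => hab (Nat.nth_injective hinf' h)
    · refine fun x => Eventually.of_forall fun n => ⟨e n, by simp, ?_⟩
      have := hf _ (Nat.nth_mem_of_infinite hinf' n)
      simp [e, this]
  · obtain ⟨N, hN⟩ := eventually_atTop.1 (not_frequently.1 hinf)
    have hc : ∀ n, range (U (N + n)) ∈ omegaCovers X := by
      refine fun n => ⟨⟨countable_range _, ?_, ?_, ?_⟩, ?_⟩
      · rintro _ ⟨m, rfl⟩; exact hU _ _
      · refine eq_univ_of_forall fun x => ?_
        obtain ⟨m, hm⟩ := hω (N + n) {x} (finite_singleton x)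
        exact ⟨_, ⟨m, rfl⟩, hm rfl⟩
      · exact hN (N + n) (by omega)
      · intro F hF
        obtain ⟨m, hm⟩ := hω (N + n) F hF
        exact ⟨_, ⟨m, rfl⟩, hm⟩
    obtain ⟨V, hV, -, e, he, her, h, hh, hx⟩ := hX _ hc
    choose f hf using hV
    -- One index per member turns the blocks of `e` into pairwise disjoint finite sets of indices of
    -- the selection.
    have : ∀ m, ∃ k, V k = e m := fun m => by
      have : e m ∈ range V := her ▸ mem_range_self m
      exact this
    choose k hk using this
    have hkinj : Function.Injective k := fun a b hab => he (by rw [← hk, ← hk, hab])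
    refine ⟨fun n => f (n - N), exists_hitsBlocks_of_pairwise_disjoint _
      (fun n => (Finset.Ico (h n) (h (n + 1))).image fun m => N + k m) ?_ ?_⟩
    · intro a b hab
      have hinj : Function.Injective fun m => N + k m := fun i j hij => hkinj (by simpa using hij)
      rw [Finset.disjoint_image hinj, ← Finset.disjoint_coe]
      simpa using hh.monotone.pairwise_disjoint_on_Ico_succ hab
    · intro x
      filter_upwards [hx x] with n hn
      simp only [mem_iUnion] at hn
      obtain ⟨m, hm, hxm⟩ := hn
      refine ⟨N + k m, Finset.mem_image.2 ⟨m, by simpa using hm, rfl⟩, ?_⟩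
      rwa [Nat.add_sub_cancel_left, hf, hk]

theorem infinite_setOf_superset_of_mem_omegaCovers {X : Type u} [TopologicalSpace X]
    {𝒰 : Set (Set X)} (h𝒰 : 𝒰 ∈ omegaCovers X) {F : Set X} (hF : F.Finite) :
    {U ∈ 𝒰 | F ⊆ U}.Infinite := by
  intro hfin
  have hmiss : ∀ U ∈ 𝒰, ∃ x, x ∉ U := fun U hU =>
    (ne_univ_iff_exists_notMem U).1 fun h => h𝒰.1.univ_notMem (h ▸ hU)
  obtain ⟨U₀, hU₀, -⟩ := h𝒰.2 F hF
  have : Nonempty X := ⟨(hmiss U₀ hU₀).choose⟩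
  choose! x hx using hmiss
  obtain ⟨U, hU, hFU⟩ := h𝒰.2 (F ∪ x '' {U ∈ 𝒰 | F ⊆ U}) (hF.union (hfin.image x))
  exact hx U hU (hFU (Or.inr ⟨U, ⟨hU, fun y hy => hFU (Or.inl hy)⟩, rfl⟩))

theorem HasBlockSelections.gerlitsNagy {X : Type u} [TopologicalSpace X]
    (hX : HasBlockSelections X) : GerlitsNagy X := by
  classical
  intro 𝒰 h𝒰
  -- With `n + 1` candidates at stage `n`, Hall's theorem yields an injective selection, which is
  -- its own bijective enumeration.
  let S : ℕ → Set (Finset (Set X)) := fun n => {t | (t : Set (Set X)) ⊆ 𝒰 n ∧ t.card = n + 1}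
  have hSω : ∀ n (F : Set X), F.Finite → ∃ t ∈ S n, F ⊆ ⋂ U ∈ t, U := by
    intro n F hF
    obtain ⟨t, ht, htc⟩ :=
      (infinite_setOf_superset_of_mem_omegaCovers (h𝒰 n) hF).exists_subset_card_eq (n + 1)
    exact ⟨t, ⟨fun U hU => (ht hU).1, htc⟩, subset_iInter₂ fun U hU => (ht hU).2⟩
  have hSc : ∀ n, (S n).Countable := fun n => by
    have := (Set.countable_ofPred_finite_subset (h𝒰 n).1.countable).preimage_of_injOn
      (f := fun t : Finset (Set X) => (t : Set (Set X))) Finset.coe_injective.injOn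
    refine this.mono fun t ht => ?_
    exact ⟨t.finite_toSet, ht.1⟩
  have hSe : ∀ n, ∃ t : ℕ → Finset (Set X), S n = range t := fun n => by
    obtain ⟨t, ht, -⟩ := hSω n ∅ finite_empty
    exact (hSc n).exists_eq_range ⟨t, ht⟩
  choose t ht using hSe
  have htS : ∀ n m, t n m ∈ S n := fun n m => ht n ▸ mem_range_self m
  obtain ⟨f, h, hh, hx⟩ := hX (fun n m => ⋂ U ∈ t n m, U)
    (fun n m => isOpen_biInter_finset fun U hU => (h𝒰 n).1.isOpen U ((htS n m).1 hU))
    (fun n F hF => by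
      obtain ⟨s, hs, hFs⟩ := hSω n F hF
      rw [ht n] at hs
      obtain ⟨m, rfl⟩ := hs
      exact ⟨m, hFs⟩)
  obtain ⟨W, hWinj, hW⟩ := (Finset.all_card_le_biUnion_card_iff_exists_injective
      (fun n => t n (f n))).1 (fun s => by
    rcases s.eq_empty_or_nonempty with rfl | hs
    · simp
    · calc s.card ≤ (Finset.range (s.max' hs + 1)).card := Finset.card_le_card fun k hk =>
            Finset.mem_range.2 (Nat.lt_succ_of_le (s.le_max' k hk))
        _ = (t (s.max' hs) (f (s.max' hs))).card := by rw [Finset.card_range, (htS _ _).2]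
        _ ≤ _ := Finset.card_le_card
            (Finset.subset_biUnion_of_mem (fun n => t n (f n)) (s.max'_mem hs)))
  have hW𝒰 : ∀ n, W n ∈ 𝒰 n := fun n => (htS n (f n)).1 (hW n)
  have hxW : ∀ x k, x ∈ ⋂ U ∈ t k (f k), U → x ∈ W k := fun x k hk =>
    mem_iInter₂.1 hk _ (hW k)
  refine ⟨W, hW𝒰, ⟨countable_range W, ?_, ?_, ?_⟩, W, hWinj, rfl, h, hh, fun x => ?_⟩
  · rintro _ ⟨n, rfl⟩; exact (h𝒰 n).1.isOpen _ (hW𝒰 n)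
  · refine eq_univ_of_forall fun x => ?_
    obtain ⟨k, hk⟩ := (hx x).nonempty
    exact ⟨_, ⟨k, rfl⟩, hxW x k hk⟩
  · rintro ⟨n, hn⟩; exact (h𝒰 n).1.univ_notMem (hn ▸ hW𝒰 n)
  · filter_upwards [hx x] with n ⟨k, hk, hxk⟩
    exact mem_iUnion₂.2 ⟨k, hk, hxW x k hxk⟩

theorem HasBlockSelections.of_countable (X : Type u) [TopologicalSpace X] [Countable X]
    [Nonempty X] : HasBlockSelections X := by
  intro U _ hω
  obtain ⟨e, he⟩ := exists_surjective_nat X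
  choose f hf using fun n => hω n (e '' Iic n) ((finite_Iic n).image e)
  refine ⟨f, id, strictMono_id, fun x => ?_⟩
  obtain ⟨i, rfl⟩ := he x
  exact eventually_atTop.2 ⟨i, fun n hn => ⟨n, by simp, hf n ⟨i, hn, rfl⟩⟩⟩

/-! ### Upper bound: discrete spaces and unions of meager sets -/

theorem exists_antitone_open_dense_of_isMeagre {E : Type*} [TopologicalSpace E] {M : Set E}
    (hM : IsMeagre M) :
    ∃ O : ℕ → Set E, Antitone O ∧ (∀ n, IsOpen (O n)) ∧ (∀ n, Dense (O n)) ∧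
      ∀ x ∈ M, ∃ n, x ∉ O n := by
  obtain ⟨S, hSo, hSd, hSc, hSM⟩ := mem_residual_iff.1 hM
  obtain ⟨T, hT⟩ := (hSc.insert Set.univ).exists_eq_range (insert_nonempty _ _)
  have hTo : ∀ n, IsOpen (T n) := fun n => by
    rcases (hT ▸ mem_range_self n : T n ∈ insert Set.univ S) with h | h
    · rw [h]; exact isOpen_univ
    · exact hSo _ h
  have hTd : ∀ n, Dense (T n) := fun n => by
    rcases (hT ▸ mem_range_self n : T n ∈ insert Set.univ S) with h | h
    · rw [h]; exact dense_univ
    · exact hSd _ h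
  have hO : ∀ n, IsOpen (⋂ i ∈ Finset.range n, T i) := fun n =>
    isOpen_biInter_finset fun i _ => hTo i
  refine ⟨fun n => ⋂ i ∈ Finset.range n, T i, ?_, hO, fun n => ?_, fun x hx => ?_⟩
  · exact fun m n hmn => biInter_subset_biInter_left fun i hi =>
      Finset.mem_range.2 ((Finset.mem_range.1 hi).trans_le hmn)
  · induction n with
    | zero => simp
    | succ n ih =>
      beta_reduce
      rw [Finset.range_add_one, Finset.set_biInter_insert]
      exact (hTd n).inter_of_isOpen_left ih (hTo n)
  · have : x ∉ ⋂₀ S := fun h => hSM h hx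
    rw [mem_sInter] at this
    push Not at this
    obtain ⟨t, ht, hxt⟩ := this
    obtain ⟨i, rfl⟩ := (hT ▸ mem_insert_of_mem _ ht : t ∈ range T)
    exact ⟨i + 1, fun h => hxt (mem_iInter₂.1 h i (by simp))⟩

section Discrete

variable {X : Type u} [TopologicalSpace X] [DiscreteTopology X]

theorem HasBlockSelections.exists_eq (hX : HasBlockSelections X) (φ : X → ℕ → ℕ) :
    ∃ s h : ℕ → ℕ, StrictMono h ∧ ∀ x, HitsBlocks {k | s k = φ x k} h := by
  -- The list coded by `m` predicts values at the positions `Nat.pair n i`; a finite set is covered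
  -- by reserving one position for each of its points.
  let L : ℕ → List ℕ := fun m => (Encodable.decode m).getD []
  obtain ⟨f, h, hh, hx⟩ := hX
    (fun n m => {x | ∃ i < (L m).length, (L m).getD i 0 = φ x (Nat.pair n i)})
    (fun _ _ => isOpen_discrete _) (fun n F hF => by
      obtain ⟨l, hl⟩ : ∃ l : List X, F = {x | x ∈ l} :=
        ⟨hF.toFinset.toList, by ext; simp⟩
      refine ⟨Encodable.encode (l.mapIdx fun i x => φ x (Nat.pair n i)), fun x hx => ?_⟩
      rw [hl] at hx
      obtain ⟨i, hi, rfl⟩ := List.getElem_of_mem hx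
      exact ⟨i, by simp [L, hi], by simp [L, hi]⟩)
  refine ⟨fun p => (L (f p.unpair.1)).getD p.unpair.2 0,
    exists_hitsBlocks_of_pairwise_disjoint _ (fun n => (Finset.Ico (h n) (h (n + 1))).biUnion
      fun k => (Finset.range (L (f k)).length).image (Nat.pair k)) ?_ fun x => ?_⟩
  · intro a b hab
    have := hh.monotone.pairwise_disjoint_on_Ico_succ hab
    rw [Finset.disjoint_left]
    simp only [Finset.mem_biUnion, Finset.mem_image]
    rintro _ ⟨k, hk, i, -, rfl⟩ ⟨k', hk', i', -, hp⟩
    obtain ⟨rfl, -⟩ := Nat.pair_eq_pair.1 hp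
    exact Set.disjoint_left.1 this (Finset.mem_Ico.1 hk) (Finset.mem_Ico.1 hk')
  · filter_upwards [hx x] with n ⟨k, hk, i, hi, hki⟩
    refine ⟨Nat.pair k i, ?_, ?_⟩
    · exact Finset.mem_biUnion.2 ⟨k, Finset.mem_Ico.2 hk,
        Finset.mem_image_of_mem _ (Finset.mem_range.2 hi)⟩
    · simpa using hki

/-- A correct guess of the running maximum of `ψ x` at some `k ≥ p` in block `p` bounds `ψ x p`. -/
theorem HasBlockSelections.exists_eventually_le (hX : HasBlockSelections X) (ψ : X → ℕ → ℕ) :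
    ∃ g : ℕ → ℕ, ∀ x, ∀ᶠ p in atTop, ψ x p ≤ g p := by
  obtain ⟨s, h, hh, hx⟩ := hX.exists_eq fun x k => (Finset.range (k + 1)).sup (ψ x)
  refine ⟨fun p => (Finset.Ico (h p) (h (p + 1))).sup s, fun x => ?_⟩
  filter_upwards [hx x] with p ⟨k, hk, hs⟩
  calc ψ x p ≤ (Finset.range (k + 1)).sup (ψ x) :=
        Finset.le_sup (Finset.mem_range.2 (Nat.lt_succ_of_le (hh.le_apply.trans hk.1)))
    _ = s k := hs.symm
    _ ≤ _ := Finset.le_sup (Finset.mem_Ico.2 hk)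

/-- Basic sets are shrunk by applying guessed tables of `t x k` successively along a block. One
right guess puts the result inside `O x k`; wrong guesses do no harm, since every step only shrinks.
-/
theorem HasBlockSelections.isMeagre_iUnion {E : Type*} [TopologicalSpace E] [Nonempty E]
    [SecondCountableTopology E] (hX : HasBlockSelections X) (M : X → Set E)
    (hM : ∀ x, IsMeagre (M x)) : IsMeagre (⋃ x, M x) := by
  choose O hOanti hOo hOd hOM using fun x => exists_antitone_open_dense_of_isMeagre (hM x)
  obtain ⟨b, hbc, hb0, hb⟩ := TopologicalSpace.exists_countable_basis E
  obtain ⟨B, rfl⟩ := hbc.exists_eq_range (by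
    obtain ⟨v, hv, -⟩ := hb.exists_subset_of_mem_open (mem_univ (Classical.arbitrary E))
      isOpen_univ
    exact ⟨v, hv⟩)
  have hBo : ∀ j, IsOpen (B j) := fun j => hb.isOpen (mem_range_self j)
  have hBn : ∀ j, (B j).Nonempty := fun j =>
    nonempty_iff_ne_empty.2 fun h => hb0 ⟨j, h⟩
  have ht : ∀ x k j, ∃ i, B i ⊆ B j ∩ O x k := fun x k j => by
    obtain ⟨z, hz⟩ := (hOd x k).inter_open_nonempty _ (hBo j) (hBn j)
    obtain ⟨_, ⟨i, rfl⟩, -, hi⟩ := hb.exists_subset_of_mem_open hz ((hBo j).inter (hOo x k))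
    exact ⟨i, hi⟩
  choose t ht using ht
  obtain ⟨g, hg⟩ := hX.exists_eventually_le fun x p =>
    (Finset.range (p + 1)).sup fun k => (Finset.range (p + 1)).sup (t x k)
  -- Eventually `t x k` maps indices up to `N k` to indices up to `N (k + 1)`, so only a finite
  -- table has to be guessed.
  let N : ℕ → ℕ := fun k => Nat.rec 0 (fun k a => max (g (max k a)) (a + 1)) k
  have hN : ∀ k, N (k + 1) = max (g (max k (N k))) (N k + 1) := fun k => rfl
  have hNmono : StrictMono N := strictMono_nat_of_lt_succ fun n => by rw [hN]; omega
  have htN : ∀ x, ∀ᶠ k in atTop, ∀ j ≤ N k, t x k j ≤ N (k + 1) := fun x => by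
    obtain ⟨K, hK⟩ := eventually_atTop.1 (hg x)
    refine eventually_atTop.2 ⟨K, fun k hk j hj => ?_⟩
    rw [hN]
    refine le_max_of_le_left (le_trans ?_ (hK (max k (N k)) (le_max_of_le_left hk)))
    refine le_trans ?_ (Finset.le_sup (b := k) (Finset.mem_range.2 (by omega)))
    exact Finset.le_sup (f := t x k) (Finset.mem_range.2 (by omega))
  obtain ⟨s, h, hh, hs⟩ := hX.exists_eq fun x k =>
    Encodable.encode ((List.range (N k + 1)).map (t x k))
  classical
  let v : ℕ → ℕ → ℕ := fun k j => ((Encodable.decode (α := List ℕ) (s k)).getD []).getD j 0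
  -- A guess that is out of bounds or does not shrink `B j` is replaced by the identity.
  let σ : ℕ → ℕ → ℕ := fun k j => if v k j ≤ N (k + 1) ∧ B (v k j) ⊆ B j then v k j else j
  have hσN : ∀ k j, j ≤ N k → σ k j ≤ N (k + 1) := fun k j hj => by
    simp only [σ]
    split_ifs with hc
    · exact hc.1
    · exact hj.trans (hNmono.monotone k.le_succ)
  have hσB : ∀ k j, B (σ k j) ⊆ B j := fun k j => by
    simp only [σ]
    split_ifs with hc
    · exact hc.2
    · exact subset_rfl
  have hσO : ∀ x, ∀ᶠ k in atTop, s k = Encodable.encode ((List.range (N k + 1)).map (t x k)) →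
      ∀ j ≤ N k, B (σ k j) ⊆ O x k := fun x => by
    filter_upwards [htN x] with k hk hsk j hj
    have hv : v k j = t x k j := by
      simp [v, hsk, List.getD, Nat.lt_succ_of_le hj]
    have hσ : σ k j = t x k j := by
      simp only [σ, hv]
      exact if_pos ⟨hk j hj, (ht x k j).trans inter_subset_left⟩
    rw [hσ]
    exact (ht x k j).trans inter_subset_right
  let T : ℕ → ℕ → ℕ → ℕ := fun a l j => Nat.rec j (fun l i => σ (a + l) i) l
  have hTs : ∀ a l j, T a (l + 1) j = σ (a + l) (T a l j) := fun a l j => rfl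
  have hTN : ∀ a l j, j ≤ N a → T a l j ≤ N (a + l) := fun a l j hj => by
    induction l with
    | zero => exact hj
    | succ l ih => rw [hTs]; exact hσN _ _ ih
  have hTB : ∀ a j, Antitone fun l => B (T a l j) := fun a j =>
    antitone_nat_of_succ_le fun l => by rw [hTs]; exact hσB _ _
  let W : ℕ → Set E := fun n => ⋃ j ∈ Iic (N (h n)), B (T (h n) (h (n + 1) - h n) j)
  have hWo : ∀ n, IsOpen (W n) := fun n => isOpen_biUnion fun j _ => hBo _
  have hWd : ∀ m, Dense (⋃ n ∈ Ici m, W n) := fun m => by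
    rw [hb.dense_iff]
    rintro _ ⟨j, rfl⟩ -
    obtain ⟨z, hz⟩ := hBn (T (h (max m j)) (h (max m j + 1) - h (max m j)) j)
    refine ⟨z, hTB _ j (Nat.zero_le _) hz, mem_iUnion₂.2 ⟨max m j, mem_Ici.2 (le_max_left _ _), ?_⟩⟩
    refine mem_iUnion₂.2 ⟨j, ?_, hz⟩
    exact (le_max_right m j).trans (hh.le_apply.trans hNmono.le_apply)
  have hWO : ∀ x, ∀ᶠ n in atTop, W n ⊆ O x n := fun x => by
    obtain ⟨K, hK⟩ := eventually_atTop.1 (hσO x)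
    filter_upwards [hs x, eventually_ge_atTop K] with n ⟨k, hk, hsk⟩ hn
    refine iUnion₂_subset fun j hj => ?_
    obtain ⟨l, rfl⟩ := Nat.exists_eq_add_of_le hk.1
    have hnk : n ≤ h n := hh.le_apply
    calc B (T (h n) (h (n + 1) - h n) j) ⊆ B (T (h n) (l + 1) j) :=
          hTB (h n) j (show l + 1 ≤ h (n + 1) - h n by have := hk.2; omega)
      _ ⊆ O x (h n + l) := hK _ (by omega) hsk _ (hTN _ _ _ hj)
      _ ⊆ O x n := hOanti x (by omega)
  have hres : ⋂ m, ⋃ n ∈ Ici m, W n ∈ residual E := countable_iInter_mem.2 fun m =>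
    residual_of_dense_open (isOpen_biUnion fun n _ => hWo n) (hWd m)
  refine mem_of_superset hres fun y hy hyM => ?_
  obtain ⟨x, hyx⟩ := mem_iUnion.1 hyM
  obtain ⟨m, hm⟩ := hOM x y hyx
  obtain ⟨K, hK⟩ := eventually_atTop.1 (hWO x)
  obtain ⟨n, hn, hyn⟩ := mem_iUnion₂.1 (mem_iInter.1 hy (max m K))
  exact hm (hOanti x ((le_max_left m K).trans hn) (hK n ((le_max_right m K).trans hn) hyn))

end Discrete

/-- `add(𝓜)` is attained. -/
theorem exists_mk_eq_addMeager :
    ∃ 𝓕 : Set (Set ℝ), (∀ A ∈ 𝓕, IsMeagre A) ∧ ¬ IsMeagre (⋃₀ 𝓕) ∧ #𝓕 = addMeager := by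
  refine csInf_mem (s := {κ | ∃ 𝓕 : Set (Set ℝ),
    (∀ A ∈ 𝓕, IsMeagre A) ∧ ¬ IsMeagre (⋃₀ 𝓕) ∧ #𝓕 = κ}) ⟨_, range singleton, ?_, ?_, rfl⟩
  · rintro _ ⟨x, rfl⟩
    refine IsNowhereDense.isMeagre ?_
    rw [IsNowhereDense, isClosed_singleton.closure_eq, interior_singleton]
  · have : ⋃₀ range (singleton : ℝ → Set ℝ) = Set.univ := by
      ext x; simp
    rw [this]
    exact not_isMeagre_of_isOpen isOpen_univ univ_nonempty

theorem exists_mem_unionDefects_le :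
    ∃ κ ∈ unionDefects.{u} (fun X _ => GerlitsNagy X) (fun X _ => GerlitsNagy X),
      κ ≤ lift.{u, 0} addMeager := by
  obtain ⟨𝓕, h𝓕, h𝓕n, h𝓕c⟩ := exists_mk_eq_addMeager
  let X := ULift.{u} 𝓕
  have hinf : Infinite X := by
    by_contra hfin
    rw [not_infinite_iff_finite] at hfin
    have : Finite 𝓕 := Finite.of_equiv X Equiv.ulift
    refine h𝓕n ?_
    rw [sUnion_eq_iUnion]
    exact isMeagre_iUnion fun A => h𝓕 A A.2
  let : TopologicalSpace X := ⊥
  have : DiscreteTopology X := ⟨rfl⟩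
  have hX : ¬ GerlitsNagy X := fun hGN => h𝓕n <| by
    refine (hGN.hasBlockSelections.isMeagre_iUnion (fun A : X => (A.down : Set ℝ))
      fun A => h𝓕 _ A.down.2).mono ?_
    exact sUnion_subset fun A hA => subset_iUnion (fun A : X => (A.down : Set ℝ)) ⟨⟨A, hA⟩⟩
  -- A fixed countably infinite set is added to each point because the pieces must be infinite.
  let g := Infinite.natEmbedding X
  let Y : X → Set X := fun x => insert x (range g)
  refine ⟨#(range Y), ⟨X, inferInstance, range Y, hinf, ?_, ?_, rfl, hX⟩, ?_⟩
  · rintro _ ⟨x, rfl⟩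
    have hc : Countable (Y x) := ((countable_range g).insert x).to_subtype
    have hi : Infinite (Y x) :=
      ((infinite_range_of_injective g.injective).mono (subset_insert _ _)).to_subtype
    exact ⟨hi, (HasBlockSelections.of_countable (Y x)).gerlitsNagy⟩
  · exact eq_univ_of_forall fun x => ⟨Y x, mem_range_self x, mem_insert _ _⟩
  · rw [← h𝓕c, ← mk_uLift]
    exact mk_range_le

/-! ### Binary digits and meager sets of reals -/

/-- Append to the integer `j` the binary digits `z a, …, z (a + l - 1)`. -/
def appendDigits (z : ℕ → Bool) (a : ℕ) (j : ℤ) : ℕ → ℤ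
  | 0 => j
  | l + 1 => 2 * appendDigits z a j l + (z (a + l)).toNat

theorem appendDigits_add (z : ℕ → Bool) (a : ℕ) (j : ℤ) (l l' : ℕ) :
    appendDigits z a j (l + l') = appendDigits z (a + l) (appendDigits z a j l) l' := by
  induction l' with
  | zero => rfl
  | succ l' ih => rw [← add_assoc, appendDigits, ih, appendDigits, add_assoc]

theorem appendDigits_congr {z w : ℕ → Bool} {a l : ℕ} (j : ℤ)
    (h : ∀ i ∈ Ico a (a + l), z i = w i) : appendDigits z a j l = appendDigits w a j l := by
  induction l with
  | zero => rfl
  | succ l ih =>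
    rw [appendDigits, appendDigits, ih fun i hi => h i ⟨hi.1, hi.2.trans (by omega)⟩,
      h (a + l) ⟨by omega, by omega⟩]

theorem eq_of_appendDigits_eq {z w : ℕ → Bool} {a l : ℕ} {j j' : ℤ}
    (h : appendDigits z a j l = appendDigits w a j' l) : ∀ i ∈ Ico a (a + l), z i = w i := by
  induction l with
  | zero => rintro i ⟨h₁, h₂⟩; omega
  | succ l ih =>
    rw [appendDigits, appendDigits] at h
    have h₁ := (z (a + l)).toNat_le
    have h₂ := (w (a + l)).toNat_le
    rintro i ⟨hai, hil⟩
    rcases Nat.lt_or_ge i (a + l) with hi | hi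
    · exact ih (by omega) i ⟨hai, hi⟩
    · obtain rfl : i = a + l := by omega
      have : (z (a + l)).toNat = (w (a + l)).toNat := by omega
      revert this
      cases z (a + l) <;> cases w (a + l) <;> simp

theorem appendDigits_mem_Ico (z : ℕ → Bool) (l : ℕ) :
    appendDigits z 0 0 l ∈ Finset.Ico (0 : ℤ) (2 ^ l) := by
  rw [Finset.mem_Ico]
  induction l with
  | zero => simp [appendDigits]
  | succ l ih =>
    have := (z (0 + l)).toNat_le
    rw [appendDigits, pow_succ]
    omega

/-- The closed dyadic interval `[j / 2 ^ a, (j + 1) / 2 ^ a]`. -/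
def dyadicIcc (a : ℕ) (j : ℤ) : Set ℝ := Icc (j / 2 ^ a) ((j + 1) / 2 ^ a)

theorem mem_dyadicIcc {a : ℕ} {j : ℤ} {x : ℝ} :
    x ∈ dyadicIcc a j ↔ j ≤ x * 2 ^ a ∧ x * 2 ^ a ≤ j + 1 := by
  have : (0 : ℝ) < 2 ^ a := by positivity
  rw [dyadicIcc, mem_Icc, div_le_iff₀ this, le_div_iff₀ this]

theorem dyadicIcc_succ_subset (a : ℕ) (j : ℤ) (d : Bool) :
    dyadicIcc (a + 1) (2 * j + d.toNat) ⊆ dyadicIcc a j := by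
  intro x hx
  rw [mem_dyadicIcc] at hx ⊢
  have h : x * 2 ^ (a + 1) = 2 * (x * 2 ^ a) := by ring
  rw [h] at hx
  have : (d.toNat : ℝ) ≤ 1 := by exact_mod_cast d.toNat_le
  have : (0 : ℝ) ≤ d.toNat := by positivity
  push_cast at hx
  constructor <;> linarith

theorem dyadicIcc_appendDigits_antitone (z : ℕ → Bool) (a : ℕ) (j : ℤ) :
    Antitone fun l => dyadicIcc (a + l) (appendDigits z a j l) :=
  antitone_nat_of_succ_le fun l => dyadicIcc_succ_subset (a + l) (appendDigits z a j l) (z (a + l))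

/-- The real number in `[0, 1]` with given binary digits. -/
noncomputable def binaryReal (z : ℕ → Bool) : ℝ :=
  ⨆ l, (appendDigits z 0 0 l : ℝ) / 2 ^ l

theorem binaryReal_mem (z : ℕ → Bool) (l : ℕ) :
    binaryReal z ∈ dyadicIcc l (appendDigits z 0 0 l) := by
  refine mem_iInter.1 (ciSup_mem_iInter_Icc_of_antitone_Icc
    (f := fun l => (appendDigits z 0 0 l : ℝ) / 2 ^ l)
    (g := fun l => ((appendDigits z 0 0 l : ℝ) + 1) / 2 ^ l) ?_ fun l => ?_) l
  · simpa [dyadicIcc] using dyadicIcc_appendDigits_antitone z 0 0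
  · gcongr; linarith

theorem exists_mem_dyadicIcc_appendDigits {a : ℕ} {j : ℤ} {x : ℝ} (hx : x ∈ dyadicIcc a j)
    (l : ℕ) : ∃ w, x ∈ dyadicIcc (a + l) (appendDigits w a j l) := by
  induction l with
  | zero => exact ⟨fun _ => false, hx⟩
  | succ l ih =>
    obtain ⟨w, hw⟩ := ih
    have key : ∃ d : Bool,
        x ∈ dyadicIcc (a + l + 1) (2 * appendDigits w a j l + d.toNat) := by
      rw [mem_dyadicIcc] at hw
      have h : x * 2 ^ (a + l + 1) = 2 * (x * 2 ^ (a + l)) := by ring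
      rcases le_total (x * 2 ^ (a + l + 1)) (2 * appendDigits w a j l + 1) with h' | h'
      · refine ⟨false, mem_dyadicIcc.2 ?_⟩
        push_cast
        simp only [Bool.toNat_false]
        constructor <;> push_cast <;> linarith
      · refine ⟨true, mem_dyadicIcc.2 ?_⟩
        push_cast
        simp only [Bool.toNat_true]
        constructor <;> push_cast <;> linarith
    obtain ⟨d, hd⟩ := key
    refine ⟨Function.update w (a + l) d, ?_⟩
    rw [appendDigits, Function.update_self, appendDigits_congr (w := w) j fun i hi =>
      Function.update_of_ne (by have := hi.2; omega) _ _]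
    exact hd

theorem exists_dyadicIcc_appendDigits_subset {V : Set ℝ} (hV : IsOpen V) {a : ℕ} {j : ℤ} {x : ℝ}
    (hx : x ∈ dyadicIcc a j) (hxV : x ∈ V) :
    ∃ l w, dyadicIcc (a + l) (appendDigits w a j l) ⊆ V := by
  obtain ⟨ε, hε, hεV⟩ := Metric.isOpen_iff.1 hV x hxV
  obtain ⟨l, hl⟩ := exists_pow_lt_of_lt_one hε (by norm_num : (1 / 2 : ℝ) < 1)
  obtain ⟨w, hw⟩ := exists_mem_dyadicIcc_appendDigits hx l
  refine ⟨l, w, fun y hy => hεV ?_⟩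
  have h2 : (1 / 2 : ℝ) ^ (a + l) ≤ (1 / 2 : ℝ) ^ l :=
    pow_le_pow_of_le_one (by norm_num) (by norm_num) (by omega)
  have h1 := Real.dist_le_of_mem_Icc hy hw
  rw [Metric.mem_ball]
  refine (h1.trans (le_of_eq ?_)).trans_lt (h2.trans_lt hl)
  rw [one_div, inv_pow]
  ring

theorem eq_of_mem_Ioo_of_mem_dyadicIcc {a : ℕ} {i j : ℤ} {x : ℝ}
    (hj : x ∈ Ioo ((j : ℝ) / 2 ^ a) ((j + 1) / 2 ^ a)) (hi : x ∈ dyadicIcc a i) : i = j := by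
  have h2 : (0 : ℝ) < 2 ^ a := by positivity
  rw [mem_Ioo, div_lt_iff₀ h2, lt_div_iff₀ h2] at hj
  rw [mem_dyadicIcc] at hi
  have h₁ : i < j + 1 := by exact_mod_cast hi.1.trans_lt hj.2
  have h₂ : j < i + 1 := by exact_mod_cast hj.1.trans_le hi.2
  omega

theorem isMeagre_binaryReal_image (c : ℕ → Bool) (h : ℕ → ℕ) (hh : StrictMono h) :
    IsMeagre (binaryReal '' {z | ∀ᶠ k in atTop, ∃ p ∈ Ico (h k) (h (k + 1)), z p ≠ c p}) := by
  have hsub : binaryReal '' {z | ∀ᶠ k in atTop, ∃ p ∈ Ico (h k) (h (k + 1)), z p ≠ c p} ⊆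
      ⋃ K, binaryReal '' {z | ∀ k ≥ K, ∃ p ∈ Ico (h k) (h (k + 1)), z p ≠ c p} := by
    rintro _ ⟨z, hz, rfl⟩
    obtain ⟨K, hK⟩ := eventually_atTop.1 hz
    exact mem_iUnion.2 ⟨K, z, hK, rfl⟩
  refine (isMeagre_iUnion fun K => IsNowhereDense.isMeagre ?_).mono hsub
  by_contra hne
  obtain ⟨x, hx⟩ := nonempty_iff_ne_empty.2 hne
  have hx0 : x ∈ dyadicIcc 0 ⌊x⌋ := mem_dyadicIcc.2 (by
    simpa using ⟨Int.floor_le x, (Int.lt_floor_add_one x).le⟩)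
  obtain ⟨b, w, hbw⟩ := exists_dyadicIcc_appendDigits_subset isOpen_interior hx0 hx
  rw [zero_add] at hbw
  let k := max K b
  have hk : b ≤ h k := (le_max_right K b).trans hh.le_apply
  obtain ⟨l, hl⟩ := Nat.exists_eq_add_of_le (hk.trans (hh k.lt_succ_self).le)
  let j := appendDigits c b (appendDigits w 0 ⌊x⌋ b) l
  -- Adjacent closed dyadic intervals share endpoints; only interior points determine the digits.
  have hV : Ioo ((j : ℝ) / 2 ^ (b + l)) ((j + 1) / 2 ^ (b + l)) ⊆ closure (binaryReal ''
      {z | ∀ k ≥ K, ∃ p ∈ Ico (h k) (h (k + 1)), z p ≠ c p}) :=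
    (Ioo_subset_Icc_self.trans ((dyadicIcc_appendDigits_antitone c b _ (Nat.zero_le l)).trans
      hbw)).trans interior_subset
  have hVn : (Ioo ((j : ℝ) / 2 ^ (b + l)) ((j + 1) / 2 ^ (b + l))).Nonempty :=
    nonempty_Ioo.2 (by gcongr; linarith)
  obtain ⟨y, hy⟩ := hVn
  obtain ⟨_, hzV, z, hz, rfl⟩ := mem_closure_iff.1 (hV hy) _ isOpen_Ioo hy
  have hj := eq_of_mem_Ioo_of_mem_dyadicIcc hzV (binaryReal_mem z (b + l))
  rw [appendDigits_add, zero_add] at hj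
  obtain ⟨p, hp, hzp⟩ := hz k (le_max_left _ _)
  exact hzp (eq_of_appendDigits_eq hj p ⟨hk.trans hp.1, hl ▸ hp.2⟩)

/-- The intervals are treated one at a time, prolonging a common word; those already inside `O` only
shrink. -/
theorem exists_forall_dyadicIcc_subset {O : Set ℝ} (hO : IsOpen O) (hOd : Dense O) (a : ℕ)
    (S : Finset ℤ) :
    ∃ l w, ∀ j ∈ S, dyadicIcc (a + l) (appendDigits w a j l) ⊆ O := by
  induction S using Finset.induction_on with
  | empty => exact ⟨0, fun _ => false, by simp⟩
  | insert j₀ S _ ih =>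
    obtain ⟨l, w, hlw⟩ := ih
    let i := appendDigits w a j₀ l
    obtain ⟨x, hx, hxO⟩ := hOd.inter_open_nonempty
      (Ioo ((i : ℝ) / 2 ^ (a + l)) ((i + 1) / 2 ^ (a + l))) isOpen_Ioo
      (nonempty_Ioo.2 (by gcongr; linarith))
    obtain ⟨l', w', hlw'⟩ := exists_dyadicIcc_appendDigits_subset hO
      (show x ∈ dyadicIcc (a + l) i from Ioo_subset_Icc_self hx) hxO
    let v : ℕ → Bool := fun p => if p < a + l then w p else w' p
    have hv : ∀ j, appendDigits v a j l = appendDigits w a j l := fun j =>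
      appendDigits_congr j fun p hp => if_pos hp.2
    have hv' : ∀ j, appendDigits v (a + l) j l' = appendDigits w' (a + l) j l' := fun j =>
      appendDigits_congr j fun p hp => if_neg hp.1.not_gt
    refine ⟨l + l', v, fun j hj => ?_⟩
    rw [← add_assoc, appendDigits_add, hv]
    rcases Finset.mem_insert.1 hj with rfl | hj
    · rw [hv']; exact hlw'
    · exact (dyadicIcc_appendDigits_antitone v (a + l) _ (Nat.zero_le l')).trans (hlw j hj)

theorem exists_forall_binaryReal_mem {O : Set ℝ} (hO : IsOpen O) (hOd : Dense O) (a : ℕ) :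
    ∃ l, ∃ w : ℕ → Bool, ∀ z, (∀ p ∈ Ico a (a + l), z p = w p) → binaryReal z ∈ O := by
  obtain ⟨l, w, h⟩ := exists_forall_dyadicIcc_subset hO hOd a (Finset.Ico 0 (2 ^ a))
  refine ⟨l, w, fun z hz => h _ (appendDigits_mem_Ico z a) ?_⟩
  have := binaryReal_mem z (a + l)
  rw [appendDigits_add, zero_add] at this
  rwa [← appendDigits_congr _ hz]

/-! ### Lower bound: amalgamating fewer than add(𝓜) selections -/

theorem isMeagre_iUnion_of_mk_lt {ι : Type u} (hι : #ι < lift.{u, 0} addMeager)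
    (M : ι → Set ℝ) (hM : ∀ i, IsMeagre (M i)) : IsMeagre (⋃ i, M i) := by
  by_contra hne
  rw [← sUnion_range] at hne
  have h1 : addMeager ≤ #(range M) :=
    csInf_le' ⟨range M, by rintro _ ⟨i, rfl⟩; exact hM i, hne, rfl⟩
  have h2 : lift.{u, 0} #(range M) ≤ lift.{0, u} #ι := mk_range_le_lift
  rw [lift_id'.{0, u}] at h2
  exact ((lift_le.2 h1).trans h2).not_gt hι

theorem exists_agree_on_block {ι : Type u} (hι : #ι < lift.{u, 0} addMeager)
    (c : ι → ℕ → Bool) (h : ι → ℕ → ℕ) (hh : ∀ i, StrictMono (h i)) :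
    ∃ (y : ℕ → Bool) (a : ℕ → ℕ), StrictMono a ∧ ∀ i, ∀ᶠ n in atTop, ∃ k,
      a n ≤ h i k ∧ h i (k + 1) ≤ a (n + 1) ∧ ∀ p ∈ Ico (h i k) (h i (k + 1)), y p = c i p := by
  obtain ⟨O, hOanti, hOo, hOd, hOM⟩ := exists_antitone_open_dense_of_isMeagre
    (isMeagre_iUnion_of_mk_lt hι _ fun i => isMeagre_binaryReal_image (c i) (h i) (hh i))
  have hw : ∀ n a : ℕ, ∃ l, ∃ w : ℕ → Bool,
      ∀ z, (∀ p ∈ Ico a (a + l), z p = w p) → binaryReal z ∈ O n := fun n =>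
    exists_forall_binaryReal_mem (hOo n) (hOd n)
  choose l w hlw using hw
  -- The `+ 1` leaves a gap after each window `[a n, a n + l n (a n))`, so an interval covered by
  -- windows lies in a single one.
  let a : ℕ → ℕ := fun n => Nat.rec 0 (fun n b => b + l n b + 1) n
  have ha : ∀ n, a (n + 1) = a n + l n (a n) + 1 := fun n => rfl
  have hmono : StrictMono a := strictMono_nat_of_lt_succ fun n => by rw [ha]; omega
  have huniq : ∀ {m n p}, p ∈ Ico (a m) (a (m + 1)) → p ∈ Ico (a n) (a (n + 1)) → m = n := by
    intro m n p hm hn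
    by_contra hne
    exact Set.disjoint_left.1 (hmono.monotone.pairwise_disjoint_on_Ico_succ hne) hm hn
  have hy : ∀ p, ∃ b : Bool, ∀ n, p ∈ Ico (a n) (a (n + 1)) → b = w n (a n) p := fun p => by
    by_cases hp : ∃ n, p ∈ Ico (a n) (a (n + 1))
    · obtain ⟨m, hm⟩ := hp
      exact ⟨w m (a m) p, fun n hn => by rw [huniq hm hn]⟩
    · exact ⟨true, fun n hn => absurd ⟨n, hn⟩ hp⟩
  choose y hy using hy
  refine ⟨y, a, hmono, fun i => ?_⟩
  by_contra hbad
  rw [not_eventually] at hbad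
  let Bad : ℕ → Prop := fun n => ¬ ∃ k, a n ≤ h i k ∧ h i (k + 1) ≤ a (n + 1) ∧
    ∀ p ∈ Ico (h i k) (h i (k + 1)), y p = c i p
  -- `z` follows `y` on the windows of bad `n` and opposes `c i` elsewhere. Agreement with `c i` on
  -- a whole block would make a bad `n` good, so `binaryReal z` lies in the meager set; yet
  -- infinitely many bad windows put it in every `O N`.
  have hz : ∀ p, ∃ b : Bool, ((∃ n, Bad n ∧ p ∈ Ico (a n) (a n + l n (a n))) → b = y p) ∧
      ((¬ ∃ n, Bad n ∧ p ∈ Ico (a n) (a n + l n (a n))) → b = !(c i p)) := fun p => by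
    by_cases hp : ∃ n, Bad n ∧ p ∈ Ico (a n) (a n + l n (a n))
    · exact ⟨y p, fun _ => rfl, fun h => absurd hp h⟩
    · exact ⟨!(c i p), fun h => absurd h hp, fun _ => rfl⟩
  choose z hzy hzc using hz
  have hz : ∀ k, ∃ p ∈ Ico (h i k) (h i (k + 1)), z p ≠ c i p := by
    intro k
    by_contra! hcon
    have hgood : ∀ p ∈ Ico (h i k) (h i (k + 1)),
        (∃ n, Bad n ∧ p ∈ Ico (a n) (a n + l n (a n))) ∧ y p = c i p := by
      intro p hp
      have := hcon p hp
      rcases Classical.em (∃ n, Bad n ∧ p ∈ Ico (a n) (a n + l n (a n))) with hn | hn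
      · exact ⟨hn, hzy p hn ▸ this⟩
      · simp [hzc p hn] at this
    obtain ⟨⟨n, hn, hp⟩, -⟩ := hgood (h i k) ⟨le_rfl, hh i k.lt_succ_self⟩
    have han := ha n
    rcases Nat.lt_or_ge (a n + l n (a n)) (h i (k + 1)) with hlt | hge
    · obtain ⟨⟨m, -, hm⟩, -⟩ := hgood (a n + l n (a n)) ⟨hp.2.le, hlt⟩
      have ham := ha m
      obtain rfl : m = n := huniq ⟨hm.1, by have := hm.2; omega⟩ ⟨by omega, by omega⟩
      exact hm.2.false
    · exact hn ⟨k, hp.1, by omega, fun p hp => (hgood p hp).2⟩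
  obtain ⟨N, hN⟩ := hOM (binaryReal z) (mem_iUnion.2 ⟨i, z, Eventually.of_forall hz, rfl⟩)
  obtain ⟨n, hn, hbn⟩ := (frequently_atTop.1 hbad) N
  refine hN (hOanti hn (hlw n (a n) z fun p hp => ?_))
  have : z p = y p := hzy p ⟨n, hbn, hp⟩
  rw [this, hy p n ⟨hp.1, by have := hp.2; have := ha n; omega⟩]

/-- Only the partitions matter here: a block of `h i` inside `[a p, a (p + 1))` starts at or after
`p`, and its right end bounds `ψ i p`. -/
theorem exists_eventually_le_of_mk_lt {ι : Type u} (hι : #ι < lift.{u, 0} addMeager)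
    (ψ : ι → ℕ → ℕ) : ∃ g : ℕ → ℕ, ∀ i, ∀ᶠ p in atTop, ψ i p ≤ g p := by
  let h : ι → ℕ → ℕ := fun i n =>
    Nat.rec 0 (fun _ b => max (b + 1) ((Finset.range (b + 1)).sup (ψ i))) n
  have hs : ∀ i n, h i (n + 1) = max (h i n + 1) ((Finset.range (h i n + 1)).sup (ψ i)) :=
    fun i n => rfl
  have hmono : ∀ i, StrictMono (h i) := fun i =>
    strictMono_nat_of_lt_succ fun n => by rw [hs]; omega
  obtain ⟨_, a, ha, H⟩ := exists_agree_on_block hι (fun _ _ => true) h hmono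
  refine ⟨fun p => a (p + 1), fun i => ?_⟩
  filter_upwards [H i] with p ⟨k, h₁, h₂, _⟩
  have hpa : p ≤ a p := ha.le_apply
  have : ψ i p ≤ (Finset.range (h i k + 1)).sup (ψ i) :=
    Finset.le_sup (Finset.mem_range.2 (by omega))
  have := hs i k
  omega

/-- Fewer than `add(𝓜)` many functions with interval partitions can be amalgamated. -/
theorem exists_amalgam {ι : Type u} (hι : #ι < lift.{u, 0} addMeager)
    (f h : ι → ℕ → ℕ) (hh : ∀ i, StrictMono (h i)) :
    ∃ F H : ℕ → ℕ, Monotone H ∧ ∀ i N, ∀ᶠ n in atTop, ∃ m ≥ N,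
      H n ≤ h i m ∧ h i (m + 1) ≤ H (n + 1) ∧ ∀ k ∈ Ico (h i m) (h i (m + 1)), F k = f i k := by
  classical
  obtain ⟨g, hg⟩ := exists_eventually_le_of_mk_lt hι f
  let L : ℕ → ℕ := fun k => ∑ j ∈ Finset.range k, (g j + 1)
  have hL : ∀ k, L (k + 1) = L k + (g k + 1) := fun k => Finset.sum_range_succ _ _
  have hLmono : StrictMono L := strictMono_nat_of_lt_succ fun n => by rw [hL]; omega
  -- The value `f i k ≤ g k` is coded by a single 1 in the segment `[L k, L (k + 1))`.
  let c : ι → ℕ → Bool := fun i p => decide (∃ k, f i k ≤ g k ∧ p = L k + f i k)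
  obtain ⟨y, a, ha, H⟩ := exists_agree_on_block hι c (fun i n => L (h i n))
    fun i => hLmono.comp (hh i)
  have hLa : ∀ n, ∃ k, a n ≤ L k := fun n => ⟨a n, hLmono.le_apply⟩
  let F : ℕ → ℕ := fun k => if hk : ∃ m ≤ g k, y (L k + m) = true then hk.choose else 0
  refine ⟨F, fun n => Nat.find (hLa n), ?_, fun i N => ?_⟩
  · exact fun m n hmn => Nat.find_mono fun k hk => (ha.monotone hmn).trans hk
  · obtain ⟨K, hK⟩ := eventually_atTop.1 (hg i)
    filter_upwards [H i, eventually_gt_atTop (L (h i (max N K)))] with n ⟨m, h₁, h₂, h₃⟩ hn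
    have hm : max N K ≤ m := by
      by_contra! hlt
      have h₄ := hLmono (hh i hlt)
      have h₅ : n ≤ a n := ha.le_apply
      omega
    have hmK : K ≤ h i m := ((le_max_right N K).trans hm).trans (hh i).le_apply
    refine ⟨m, (le_max_left N K).trans hm, Nat.find_min' _ h₁,
      hLmono.le_iff_le.1 (h₂.trans (Nat.find_spec (hLa (n + 1)))), fun k hk => ?_⟩
    have hgk : f i k ≤ g k := hK k (hmK.trans hk.1)
    have hyc : ∀ q ≤ g k, y (L k + q) = c i (L k + q) := fun q hq => by
      refine h₃ _ ⟨(hLmono.monotone hk.1).trans (Nat.le_add_right _ _), ?_⟩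
      have h₆ := hLmono.monotone (Nat.succ_le_of_lt hk.2)
      rw [hL] at h₆
      omega
    have hex : ∃ m ≤ g k, y (L k + m) = true := by
      refine ⟨f i k, hgk, ?_⟩
      rw [hyc _ hgk]
      exact decide_eq_true ⟨k, hgk, rfl⟩
    have hF : F k = hex.choose := dif_pos hex
    obtain ⟨hq, hyq⟩ := hex.choose_spec
    rw [← hF] at hq hyq
    rw [hyc _ hq, decide_eq_true_iff] at hyq
    obtain ⟨k', hk', heq⟩ := hyq
    have hkk : k = k' := by
      by_contra hne
      have h₇ := hL k
      have h₈ := hL k'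
      exact Set.disjoint_left.1 (hLmono.monotone.pairwise_disjoint_on_Ico_succ hne)
        (show L k + F k ∈ Ico (L k) (L (k + 1)) from ⟨by omega, by omega⟩)
        (show L k + F k ∈ Ico (L k') (L (k' + 1)) from ⟨by omega, by omega⟩)
    subst hkk
    omega

theorem HasBlockSelections.sUnion {X : Type u} [TopologicalSpace X] (𝒴 : Set (Set X))
    (h𝒴 : #𝒴 < lift.{u, 0} addMeager) (hP : ∀ Y ∈ 𝒴, HasBlockSelections Y)
    (hcov : ⋃₀ 𝒴 = Set.univ) : HasBlockSelections X := by
  intro U hU hω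
  have : ∀ Y : 𝒴, ∃ f h : ℕ → ℕ, StrictMono h ∧
      ∀ x : (Y : Set X), HitsBlocks {k | (x : X) ∈ U k (f k)} h := fun Y =>
    hP Y Y.2 (fun n m => Subtype.val ⁻¹' U n m)
      (fun n m => (hU n m).preimage continuous_subtype_val) fun n G hG => by
        obtain ⟨m, hm⟩ := hω n (Subtype.val '' G) (hG.image _)
        exact ⟨m, image_subset_iff.1 hm⟩
  choose f h hh hx using this
  obtain ⟨F, H, hH, hFH⟩ := exists_amalgam h𝒴 f h hh
  refine ⟨F, exists_hitsBlocks_of_pairwise_disjoint _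
    (fun n => Finset.Ico (H n) (H (n + 1))) ?_ fun x => ?_⟩
  · intro a b hab
    rw [← Finset.disjoint_coe]
    simpa using hH.pairwise_disjoint_on_Ico_succ hab
  · obtain ⟨Y, hY, hxY⟩ := mem_sUnion.1 (hcov ▸ mem_univ x : x ∈ ⋃₀ 𝒴)
    obtain ⟨N, hN⟩ := eventually_atTop.1 (hx ⟨Y, hY⟩ ⟨x, hxY⟩)
    filter_upwards [hFH ⟨Y, hY⟩ N] with n ⟨m, hm, h₁, h₂, h₃⟩
    obtain ⟨k, hk, hxk⟩ := hN m hm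
    refine ⟨k, Finset.mem_Ico.2 ⟨h₁.trans hk.1, hk.2.trans_le h₂⟩, ?_⟩
    rw [h₃ k hk]
    exact hxk

end SelectionPrinciples

/-- The additivity number of the Gerlits–Nagy property is `add(𝓜)`. The first conjunct says that
the minimum defining the additivity number is taken over a nonempty set. Spaces range over an
arbitrary universe, so the cardinal `add(𝓜)` is lifted to it. -/
theorem theorem2p3 :
    (SelectionPrinciples.unionDefects.{u} (fun X _ => SelectionPrinciples.GerlitsNagy X)
      (fun X _ => SelectionPrinciples.GerlitsNagy X)).Nonempty ∧
    SelectionPrinciples.addNumber.{u} (fun X _ => SelectionPrinciples.GerlitsNagy X) =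
      Cardinal.lift.{u, 0} SelectionPrinciples.addMeager := by
  obtain ⟨κ, hκ, hle⟩ := SelectionPrinciples.exists_mem_unionDefects_le.{u}
  refine ⟨⟨κ, hκ⟩, le_antisymm ((csInf_le' hκ).trans hle) (le_csInf ⟨κ, hκ⟩ ?_)⟩
  rintro _ ⟨X, _, 𝒴, -, h𝒴, hcov, rfl, hX⟩
  by_contra! hlt
  exact hX (SelectionPrinciples.HasBlockSelections.sUnion 𝒴 hlt
    (fun Y hY => (h𝒴 Y hY).2.hasBlockSelections) hcov).gerlitsNagy
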